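/- For a compact operator $T$ between complex Hilbert spaces let $n(\lambda,T)$ be the number of its singular values (square roots of eigenvalues of $T^*T$, counted with multiplicity) that are greater than $\lambda>0$, and put $D^{\theta}(T)=\limsup_{\lambda\to0+}\lambda^{\theta}n(\lambda,T)$. Let $\Sigma_\theta$ be the set of compact $T$ with $D^\theta(T)<\infty$, and $\Sigma_\theta^\circ$ the set of compact $T$ with $D^\theta(T)=0$. For a bounded operator $T$ on a Hilbert space write $|T|=(T^*T)^{1/2}$, and for self-adjoint $T$ write $T_\pm=\frac12(|T|\pm T)$. Theorem. Let $\theta>0$, let $\mathcal H,\mathcal G$ be complex Hilbert spaces, $A$ a compact operator in $\mathcal H$, $\gamma$ a linear operator from a linear subspace of $\mathcal H$ to $\mathcal G$ whose domain contains the range of $A$ and for which $\gamma A:\mathcal H\to\mathcal G$ is bounded, and $V$ a bounded operator in $\mathcal G$. Put $T(V)=(\gamma A)^*V(\gamma A)$. Below, a condition on an operator $\gamma B$ includes that the domain of $\gamma$ contains the range of $B$, and $\gamma B\in\Sigma_{2\theta}$ (or $\Sigma^\circ_{2\theta}$) includes that $\gamma B:\mathcal H\to\mathcal G$ is bounded.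 Suppose that there is a bounded operator $\tilde V$ in $\mathcal H$ (a lift of $V$) with $$V\gamma A=\gamma\tilde VA,\quad V^*\gamma A^*=\gamma\tilde V^*A^*,\quad V^*\gamma A=\gamma\tilde V^*A,\quad V\gamma A^*=\gamma\tilde VA^*,$$ such that $$\gamma A,\ \gamma\tilde VA,\ \gamma\tilde V^*A\in\Sigma_{2\theta},\qquad \gamma[\tilde V,A],\ \gamma[\tilde V^*,A]\in\Sigma^\circ_{2\theta},$$ and that there is a family $Y_\varepsilon$, $\varepsilon>0$, of positive (that is, self-adjoint non-negative) bounded operators in $\mathcal H$ such that, for every $\varepsilon>0$, the operator $\gamma(|\tilde V|^2-Y_\varepsilon^2)A$ is compact with $$D^{2\theta}\big(\gamma(|\tilde V|^2-Y_\varepsilon^2)A\big)\le\varepsilon,\qquad \gamma[Y_\varepsilon,A],\ \gamma[Y_\varepsilon,A^*]\in\Sigma^\circ_{2\theta}.$$ Then $T(|V|)-|T(V)|\in\Sigma^\circ_\theta$. If, in addition, $V$ is self-adjoint, then also $T(V)_\pm-T(V_\pm)\in\Sigma^\circ_\theta$ for both signs. -/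

import Mathlib

open scoped InnerProductSpace ENNReal Topology

namespace SignSep

variable {H G : Type*}
  [NormedAddCommGroup H] [InnerProductSpace ℂ H] [CompleteSpace H]
  [NormedAddCommGroup G] [InnerProductSpace ℂ G] [CompleteSpace G]

/-- The counting function `n(t, T)` of the singular values of `T`, that is, of the square roots of
the eigenvalues of `T* T`: the number of singular values greater than `t`, counted with
multiplicity. Eigenspaces for different eigenvalues are independent, so this number is the
dimension of the span of all eigenspaces of `T* T` for eigenvalues greater than `t ^ 2`.
It is used for compact `T` and `t > 0`. -/
noncomputable def singCount (t : ℝ) (T : H →L[ℂ] G) : ℕ∞ :=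
  Cardinal.toENat (Module.rank ℂ
    (⨆ μ : Set.Ioi (t ^ 2), Module.End.eigenspace
      ((T.adjoint ∘L T : H →L[ℂ] H) : Module.End ℂ H) ((μ : ℝ) : ℂ) : Submodule ℂ H))

/-- The upper asymptotic coefficient `D^θ(T) = limsup_{t → 0+} t ^ θ * n(t, T)`. -/
noncomputable def upperCoeff (θ : ℝ) (T : H →L[ℂ] G) : ℝ≥0∞ :=
  Filter.limsup (fun t : ℝ => ENNReal.ofReal (t ^ θ) * ((singCount t T : ℕ∞) : ℝ≥0∞)) (𝓝[>] 0)

/-- The weak Schatten ideal `Σ_θ`. -/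
def weakSchatten (θ : ℝ) : Set (H →L[ℂ] G) :=
  {T | IsCompactOperator T ∧ upperCoeff θ T < ∞}

/-- The separable ideal `Σ_θ°`. -/
def weakSchattenZero (θ : ℝ) : Set (H →L[ℂ] G) :=
  {T | IsCompactOperator T ∧ upperCoeff θ T = 0}

/-- `Z` is the composition `γ B`: the partially defined operator `γ` is defined on the range of
`B`, and `γ B` is the (everywhere defined, bounded) operator `Z`. -/
def IsTraceComp (γ : H →ₗ.[ℂ] G) (B : H →L[ℂ] H) (Z : H →L[ℂ] G) : Prop :=
  ∀ x : H, ∃ h : B x ∈ γ.domain, γ ⟨B x, h⟩ = Z x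

/-- `W γ B = γ L B`, where all terms are defined on the whole space. -/
def LiftsOn (γ : H →ₗ.[ℂ] G) (W : G →L[ℂ] G) (L B : H →L[ℂ] H) : Prop :=
  ∀ x : H, ∃ (h₁ : B x ∈ γ.domain) (h₂ : L (B x) ∈ γ.domain),
    W (γ ⟨B x, h₁⟩) = γ ⟨L (B x), h₂⟩

/-- `γ B ∈ Σ_θ`. -/
def TraceMem (γ : H →ₗ.[ℂ] G) (B : H →L[ℂ] H) (θ : ℝ) : Prop :=
  ∃ Z : H →L[ℂ] G, IsTraceComp γ B Z ∧ Z ∈ weakSchatten θ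

/-- `γ B ∈ Σ_θ°`. -/
def TraceMemZero (γ : H →ₗ.[ℂ] G) (B : H →L[ℂ] H) (θ : ℝ) : Prop :=
  ∃ Z : H →L[ℂ] G, IsTraceComp γ B Z ∧ Z ∈ weakSchattenZero θ

/-- `T(V) = (γA)* V (γA)`, with `Z` the operator `γA`. -/
noncomputable def opT (Z : H →L[ℂ] G) (V : G →L[ℂ] G) : H →L[ℂ] H :=
  Z.adjoint ∘L V ∘L Z

/-- The absolute value `(T* T)^{1/2}` of a bounded operator. -/
noncomputable def absOp (T : H →L[ℂ] H) : H →L[ℂ] H := CFC.sqrt (T.adjoint ∘L T)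

/-- The positive part `(|T| + T) / 2` of a self-adjoint operator. -/
noncomputable def posOp (T : H →L[ℂ] H) : H →L[ℂ] H := (1 / 2 : ℂ) • (absOp T + T)

/-- The negative part `(|T| - T) / 2` of a self-adjoint operator. -/
noncomputable def negOp (T : H →L[ℂ] H) : H →L[ℂ] H := (1 / 2 : ℂ) • (absOp T - T)

end SignSep

/-! Write `Z` for `γA` and `L` for the lift. Since `γ` carries `LA` to `VZ`, the operator `VZ - ZL`
is the trace of the commutator `[L, A]`, hence negligible (in the separable ideal of order `2θ`);
likewise `V*Z - ZL*`. The theorem reduces to these two facts about `Z`.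

The absolute values inherit the intertwining. With `a = |V|` and `b = |L|`, the operator `K = a²Z -
Zb² = V*(VZ - ZL) + (V*Z - ZL*)L` is negligible, and `X = aZ - Zb` solves the Sylvester equation `aX
+ Xb = K`. The alternating direction iteration rests on `(a+p)X(b+p) - (a-p)X(b-p) = 2pK`: replacing
`X` by `c(a) X c(b)`, with `c(x) = (x-p)/(x+p)`, costs only a multiple of a two-sided product with
`K`. A product `g` of such factors with `|x g(x)| ≤ τ` on both spectra leaves `g(a) X g(b) = g(a)a Z
g(b) - g(a) Z b g(b)`, of size `τ^θ` in the weak ideal of order `θ` containing `Z`. Letting `τ → 0`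
gives `intertwine_sqrt_mem`.

Moving `U` and `U*` through `Z` shows that `T(U)*T(U)` equals `Z*Z Z*U*U Z` modulo the separable
ideal of order `θ/2` (`opT_adjoint_comp_opT_mem`). For `U = V` and `U = |V|` this is the same
operator, so `T(|V|)²` and `|T(V)|²` agree. The square roots then agree to order `θ` by
`sub_mem_of_sq_sub_sq_mem`: the same iteration, now with rank and error budgets chosen separately
for each shift. -/

namespace SignSep

/-! ### Approximation by operators of finite rank -/

section Apx

variable {H G K : Type*}
  [NormedAddCommGroup H] [InnerProductSpace ℂ H]
  [NormedAddCommGroup G] [InnerProductSpace ℂ G]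
  [NormedAddCommGroup K] [InnerProductSpace ℂ K]

/-- `T` is at distance at most `t` from an operator of rank at most `k`. -/
def Apx (T : H →L[ℂ] G) (k : ℕ) (t : ℝ) : Prop :=
  ∃ F : H →L[ℂ] G, LinearMap.rank (F : H →ₗ[ℂ] G) ≤ (k : Cardinal) ∧ ‖T - F‖ ≤ t

theorem Apx.mono {T : H →L[ℂ] G} {k l : ℕ} {s t : ℝ} (h : Apx T k s) (hk : k ≤ l) (hs : s ≤ t) :
    Apx T l t := by
  obtain ⟨F, hF, hn⟩ := h
  exact ⟨F, hF.trans (by exact_mod_cast hk), hn.trans hs⟩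

theorem apx_of_norm_le {T : H →L[ℂ] G} {t : ℝ} (h : ‖T‖ ≤ t) : Apx T 0 t :=
  ⟨0, by simp [LinearMap.rank_zero], by simpa using h⟩

theorem Apx.add {S T : H →L[ℂ] G} {k l : ℕ} {s t : ℝ} (hS : Apx S k s) (hT : Apx T l t) :
    Apx (S + T) (k + l) (s + t) := by
  obtain ⟨F, hF, hn⟩ := hS
  obtain ⟨F', hF', hn'⟩ := hT
  refine ⟨F + F', ?_, ?_⟩
  · rw [ContinuousLinearMap.toLinearMap_add]
    exact (LinearMap.rank_add_le _ _).trans (by push_cast; exact add_le_add hF hF')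
  · rw [add_sub_add_comm]
    exact (norm_add_le _ _).trans (add_le_add hn hn')

theorem rank_comp_le_nat_left {f : G →ₗ[ℂ] K} {g : H →ₗ[ℂ] G} {k : ℕ}
    (hf : LinearMap.rank f ≤ (k : Cardinal)) : LinearMap.rank (f ∘ₗ g) ≤ (k : Cardinal) :=
  (LinearMap.rank_comp_le_left _ _).trans hf

theorem rank_comp_le_nat_right {f : G →ₗ[ℂ] K} {g : H →ₗ[ℂ] G} {k : ℕ}
    (hg : LinearMap.rank g ≤ (k : Cardinal)) : LinearMap.rank (f ∘ₗ g) ≤ (k : Cardinal) := by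
  have h := LinearMap.lift_rank_comp_le_right g f
  rw [← Cardinal.lift_le_nat_iff]
  exact h.trans (Cardinal.lift_le_nat_iff.2 hg)

/-- The product of approximable operators is approximable. -/
theorem Apx.comp {S : G →L[ℂ] K} {T : H →L[ℂ] G} {k l : ℕ} {s t : ℝ}
    (hS : Apx S k s) (hT : Apx T l t) : Apx (S ∘L T) (k + l) (s * t) := by
  obtain ⟨F, hF, hn⟩ := hS
  obtain ⟨F', hF', hn'⟩ := hT
  -- With this witness the error factors as `(S - F)(T - F')`, so the errors multiply while the
  -- ranks add.
  refine ⟨F ∘L T + (S - F) ∘L F', ?_, ?_⟩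
  · rw [ContinuousLinearMap.toLinearMap_add]
    refine (LinearMap.rank_add_le _ _).trans ?_
    push_cast
    exact add_le_add (rank_comp_le_nat_left hF) (rank_comp_le_nat_right hF')
  · have : S ∘L T - (F ∘L T + (S - F) ∘L F') = (S - F) ∘L (T - F') := by
      ext x; simp; abel
    rw [this]
    exact (ContinuousLinearMap.opNorm_comp_le _ _).trans
      (mul_le_mul hn hn' (norm_nonneg _) ((norm_nonneg _).trans hn))

theorem Apx.comp_left {T : H →L[ℂ] G} {k : ℕ} {t b : ℝ} (hT : Apx T k t) {B : G →L[ℂ] K}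
    (hB : ‖B‖ ≤ b) : Apx (B ∘L T) k (b * t) := by
  simpa using (apx_of_norm_le hB).comp hT

theorem Apx.comp_right {T : G →L[ℂ] K} {k : ℕ} {t b : ℝ} (hT : Apx T k t) {B : H →L[ℂ] G}
    (hB : ‖B‖ ≤ b) : Apx (T ∘L B) k (t * b) := by
  simpa using hT.comp (apx_of_norm_le hB)

/-- If `P` projects onto the range of `F`, then `F = PF`, so `F* = F*P` factors through that
finite-dimensional range. -/
theorem rank_adjoint_le [CompleteSpace H] [CompleteSpace G] {F : H →L[ℂ] G} {k : ℕ}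
    (hF : LinearMap.rank (F : H →ₗ[ℂ] G) ≤ (k : Cardinal)) :
    LinearMap.rank (F.adjoint : G →ₗ[ℂ] H) ≤ (k : Cardinal) := by
  have hfin : FiniteDimensional ℂ (LinearMap.range (F : H →ₗ[ℂ] G)) :=
    Module.rank_lt_aleph0_iff.1 (lt_of_le_of_lt hF (Cardinal.natCast_lt_aleph0 (n := k)))
  set W := LinearMap.range (F : H →ₗ[ℂ] G) with hW
  have h1 : F.adjoint = (F.adjoint ∘L W.subtypeL) ∘L W.orthogonalProjectionOnto := by
    have : W.starProjection ∘L F = F := by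
      ext x
      exact Submodule.starProjection_eq_self_iff.2 ⟨x, rfl⟩
    have h2 := congrArg ContinuousLinearMap.adjoint this
    rw [ContinuousLinearMap.adjoint_comp] at h2
    have h3 : ContinuousLinearMap.adjoint W.starProjection = W.starProjection := by
      have := isSelfAdjoint_starProjection W
      rwa [ContinuousLinearMap.isSelfAdjoint_iff'] at this
    rw [h3] at h2
    conv_lhs => rw [← h2]
    ext x
    simp
  rw [h1]
  refine rank_comp_le_nat_left ?_
  have h := lift_rank_range_le ((F.adjoint ∘L W.subtypeL : W →L[ℂ] H) : W →ₗ[ℂ] H)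
  rw [← Cardinal.lift_le_nat_iff]
  exact h.trans (Cardinal.lift_le_nat_iff.2 hF)

theorem Apx.adjoint [CompleteSpace H] [CompleteSpace G] {T : H →L[ℂ] G} {k : ℕ} {t : ℝ}
    (h : Apx T k t) : Apx T.adjoint k t := by
  obtain ⟨F, hF, hn⟩ := h
  exact ⟨F.adjoint, rank_adjoint_le hF, by rw [← map_sub, LinearIsometryEquiv.norm_map]; exact hn⟩

theorem isCompactOperator_of_apx [CompleteSpace G] {T : H →L[ℂ] G}
    (h : ∀ t : ℝ, 0 < t → ∃ k, Apx T k t) : IsCompactOperator T := by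
  have hcl : T ∈ closure {S : H →L[ℂ] G | IsCompactOperator S} := by
    rw [Metric.mem_closure_iff]
    intro ε hε
    obtain ⟨k, F, hF, hn⟩ := h (ε / 2) (by positivity)
    refine ⟨F, ?_, by rw [dist_eq_norm]; linarith⟩
    have hfin : FiniteDimensional ℂ (LinearMap.range (F : H →ₗ[ℂ] G)) :=
      Module.rank_lt_aleph0_iff.1 (lt_of_le_of_lt hF (Cardinal.natCast_lt_aleph0 (n := k)))
    have hc : IsCompactOperator (F.rangeRestrict) :=
      have := FiniteDimensional.proper ℂ (LinearMap.range (F : H →ₗ[ℂ] G))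
      isCompactOperator_of_locallyCompactSpace_dom F.rangeRestrict
    exact hc.clm_comp (LinearMap.range (F : H →ₗ[ℂ] G)).subtypeL
  rwa [(isClosed_setOfPred_isCompactOperator).closure_eq] at hcl

end Apx

/-! ### Singular value counts as approximation numbers -/

section Spectral

variable {H G : Type*}
  [NormedAddCommGroup H] [InnerProductSpace ℂ H]
  [NormedAddCommGroup G] [InnerProductSpace ℂ G]

/-- Vectors in a sum of eigenspaces of a symmetric operator decompose orthogonally. -/
theorem exists_sum_of_mem_iSup_eigenspace {S : Module.End ℂ H} (hS : S.IsSymmetric)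
    {s : Set ℝ} {x : H} (hx : x ∈ ⨆ μ : s, Module.End.eigenspace S ((μ : ℝ) : ℂ)) :
    ∃ (J : Finset s) (v : s → H), x = ∑ μ ∈ J, v μ ∧ ‖x‖ ^ 2 = ∑ μ ∈ J, ‖v μ‖ ^ 2 ∧
      (⟪S x, x⟫_ℂ).re = ∑ μ ∈ J, (μ : ℝ) * ‖v μ‖ ^ 2 := by
  obtain ⟨f, hf, rfl⟩ := (Submodule.mem_iSup_iff_exists_finsupp _ _).1 hx
  have horth : ∀ μ ν : s, μ ≠ ν → ⟪f μ, f ν⟫_ℂ = 0 := by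
    intro μ ν hμν
    have hne : ((μ : ℝ) : ℂ) ≠ ((ν : ℝ) : ℂ) := by
      exact_mod_cast fun h => hμν (Subtype.ext h)
    exact (hS.orthogonalFamily_eigenspaces).pairwise hne.symm (hf ν) _ (hf μ)
  have hsum : ∀ c : s → ℂ, ⟪∑ μ ∈ f.support, c μ • f μ, ∑ μ ∈ f.support, f μ⟫_ℂ
      = ∑ μ ∈ f.support, (starRingEnd ℂ) (c μ) * (‖f μ‖ ^ 2 : ℝ) := by
    intro c
    rw [sum_inner]
    refine Finset.sum_congr rfl fun μ hμ => ?_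
    rw [inner_sum, Finset.sum_eq_single μ]
    · rw [inner_smul_left, inner_self_eq_norm_sq_to_K]; norm_cast
    · intro ν _ hν
      rw [inner_smul_left, horth μ ν hν.symm, mul_zero]
    · intro h; exact absurd hμ h
  refine ⟨f.support, f, rfl, ?_, ?_⟩
  · change ‖∑ μ ∈ f.support, f μ‖ ^ 2 = _
    have h1 := hsum fun _ => 1
    simp only [one_smul, map_one, one_mul, inner_self_eq_norm_sq_to_K] at h1
    apply Complex.ofReal_injective
    push_cast
    simpa using h1
  · have h2 : S (∑ μ ∈ f.support, f μ) = ∑ μ ∈ f.support, ((μ : ℝ) : ℂ) • f μ := by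
      rw [map_sum]
      exact Finset.sum_congr rfl fun μ _ => Module.End.mem_eigenspace_iff.1 (hf μ)
    change (⟪S (∑ μ ∈ f.support, f μ), ∑ μ ∈ f.support, f μ⟫_ℂ).re = _
    rw [h2, hsum]
    simp only [Complex.conj_ofReal]
    rw [← Complex.ofReal_re (∑ μ ∈ f.support, (μ : ℝ) * ‖f μ‖ ^ 2)]
    push_cast
    rfl

variable [CompleteSpace H] [CompleteSpace G]

theorem isSymmetric_adjoint_comp (T : H →L[ℂ] G) :
    LinearMap.IsSymmetric ((T.adjoint ∘L T : H →L[ℂ] H) : H →ₗ[ℂ] H) :=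
  (ContinuousLinearMap.isPositive_adjoint_comp_self T).isSymmetric

theorem re_inner_adjoint_comp (T : H →L[ℂ] G) (x : H) :
    (⟪((T.adjoint ∘L T : H →L[ℂ] H) : Module.End ℂ H) x, x⟫_ℂ).re = ‖T x‖ ^ 2 := by
  have : ⟪((T.adjoint ∘L T : H →L[ℂ] H) : Module.End ℂ H) x, x⟫_ℂ = ⟪T x, T x⟫_ℂ := by
    simp [ContinuousLinearMap.adjoint_inner_left]
  rw [this, inner_self_eq_norm_sq_to_K]
  norm_cast

/-- The span of the eigenspaces of `T* T` for eigenvalues greater than `t ^ 2`. -/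
noncomputable abbrev upperSpan (t : ℝ) (T : H →L[ℂ] G) : Submodule ℂ H :=
  ⨆ μ : Set.Ioi (t ^ 2), Module.End.eigenspace
      ((T.adjoint ∘L T : H →L[ℂ] H) : Module.End ℂ H) ((μ : ℝ) : ℂ)

/-- In the orthogonal decomposition of `x` into eigenvectors `v μ`, the difference `‖T x‖² - t²‖x‖²`
is the sum of `(μ - t²)‖v μ‖²`, with every coefficient positive. -/
theorem eq_zero_of_mem_upperSpan {T : H →L[ℂ] G} {t : ℝ} {x : H}
    (hx : x ∈ upperSpan t T) (h : ‖T x‖ ≤ t * ‖x‖) : x = 0 := by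
  obtain ⟨J, v, hxv, hn, hq⟩ := exists_sum_of_mem_iSup_eigenspace (isSymmetric_adjoint_comp T) hx
  rw [re_inner_adjoint_comp] at hq
  have h1 : ‖T x‖ ^ 2 ≤ t ^ 2 * ‖x‖ ^ 2 := by
    rw [← mul_pow]; exact pow_le_pow_left₀ (norm_nonneg _) h 2
  rw [hq, hn, Finset.mul_sum, ← sub_nonneg, ← Finset.sum_sub_distrib] at h1
  have h3 : ∀ μ ∈ J, t ^ 2 * ‖v μ‖ ^ 2 - μ * ‖v μ‖ ^ 2 ≤ 0 := by
    intro μ _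
    have := (Set.mem_Ioi.1 μ.2).le
    nlinarith [sq_nonneg ‖v μ‖]
  have h4 := (Finset.sum_eq_zero_iff_of_nonpos h3).1 (le_antisymm (Finset.sum_nonpos h3) h1)
  rw [hxv]
  refine Finset.sum_eq_zero fun μ hμ => ?_
  have h5 := h4 μ hμ
  rw [← sub_mul] at h5
  have h6 := Set.mem_Ioi.1 μ.2
  rcases mul_eq_zero.1 h5 with h | h
  · linarith
  · simpa using h

/-- A vector of the spectral span killed by `F` satisfies `‖T x‖ ≤ t‖x‖` and so vanishes; thus `F`
is injective there and its rank bounds the dimension. -/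
theorem singCount_le_of_apx {T : H →L[ℂ] G} {t : ℝ} {k : ℕ} (h : Apx T k t) :
    singCount t T ≤ k := by
  obtain ⟨F, hF, hn⟩ := h
  have hinj : Function.Injective
      ((F : H →ₗ[ℂ] G).rangeRestrict ∘ₗ (upperSpan t T).subtype) := by
    rw [← LinearMap.ker_eq_bot, LinearMap.ker_eq_bot']
    intro x hx
    have hFx : F x = 0 := congrArg Subtype.val hx
    have : (x : H) = 0 := by
      refine eq_zero_of_mem_upperSpan x.2 ?_
      have h1 : T x = (T - F) x := by simp [hFx]
      rw [h1]
      exact (ContinuousLinearMap.le_opNorm _ _).trans (by gcongr)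
    exact Subtype.ext this
  have h1 := LinearMap.lift_rank_le_of_injective _ hinj
  have h2 : Module.rank ℂ (upperSpan t T) ≤ (k : Cardinal) := by
    rw [← Cardinal.lift_le_nat_iff]
    exact h1.trans (Cardinal.lift_le_nat_iff.2 hF)
  exact Cardinal.toENat_le_natCast.2 h2

/-- By the spectral theorem for the compact operator `T* T`, the orthogonal complement lies in the
closure of the span of the eigenspaces for eigenvalues at most `t²`. The bound holds on that span
and passes to the closure. -/
theorem norm_apply_le_of_mem_orthogonal {T : H →L[ℂ] G} (hT : IsCompactOperator T) {t : ℝ}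
    (ht : 0 ≤ t) {x : H} (hx : x ∈ (upperSpan t T)ᗮ) : ‖T x‖ ≤ t * ‖x‖ := by
  set S : Module.End ℂ H := ((T.adjoint ∘L T : H →L[ℂ] H) : Module.End ℂ H) with hS
  have hsym : S.IsSymmetric := isSymmetric_adjoint_comp T
  have hcomp : IsCompactOperator S := hT.clm_comp T.adjoint
  set U : Submodule ℂ H := ⨆ μ : Set.Iic (t ^ 2), Module.End.eigenspace S ((μ : ℝ) : ℂ) with hU
  have hperp : U ≤ (upperSpan t T)ᗮ := by
    refine iSup_le fun μ => ?_
    rw [← Submodule.isOrtho_iff_le, Submodule.isOrtho_iSup_right]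
    intro ν
    have hne : ((μ : ℝ) : ℂ) ≠ ((ν : ℝ) : ℂ) := by
      have := lt_of_le_of_lt (Set.mem_Iic.1 μ.2) (Set.mem_Ioi.1 ν.2)
      exact_mod_cast this.ne
    exact hsym.orthogonalFamily_eigenspaces.isOrtho hne
  have hbot : (upperSpan t T)ᗮ ⊓ Uᗮ = ⊥ := by
    rw [Submodule.inf_orthogonal, eq_bot_iff,
      ← ContinuousLinearMap.orthogonalComplement_iSup_eigenspaces_eq_bot
        (T := T.adjoint ∘L T) hcomp hsym]
    refine Submodule.orthogonal_le (iSup_le fun μ => ?_)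
    by_cases hμ : Module.End.HasEigenvalue S μ
    · have h1 : ((μ.re : ℝ) : ℂ) = μ := Complex.conj_eq_iff_re.1 (hsym.conj_eigenvalue_eq_self hμ)
      rw [← h1]
      rcases le_or_gt μ.re (t ^ 2) with h | h
      · exact (le_iSup (fun ν : Set.Iic (t ^ 2) =>
          Module.End.eigenspace S ((ν : ℝ) : ℂ)) ⟨μ.re, h⟩).trans le_sup_right
      · exact (le_iSup (fun ν : Set.Ioi (t ^ 2) =>
          Module.End.eigenspace S ((ν : ℝ) : ℂ)) ⟨μ.re, h⟩).trans le_sup_left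
    · rw [Module.End.HasEigenvalue, Module.End.HasUnifEigenvalue, not_not] at hμ
      exact hμ.le.trans bot_le
  have hxcl : x ∈ closure (U : Set H) := by
    have hcl : U.topologicalClosure ≤ (upperSpan t T)ᗮ :=
      U.topologicalClosure_minimal hperp (Submodule.isClosed_orthogonal _)
    have hP : x - U.topologicalClosure.starProjection x = 0 := by
      have h1 : x - U.topologicalClosure.starProjection x ∈ (upperSpan t T)ᗮ ⊓ Uᗮ := by
        refine ⟨Submodule.sub_mem _ hx (hcl (Submodule.starProjection_apply_mem _ _)), ?_⟩
        rw [← Submodule.orthogonal_closure]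
        exact Submodule.sub_starProjection_mem_orthogonal x
      rwa [hbot, Submodule.mem_bot] at h1
    have h2 : U.topologicalClosure.starProjection x ∈ U.topologicalClosure :=
      Submodule.starProjection_apply_mem _ _
    rw [← sub_eq_zero.1 hP] at h2
    exact h2
  have hclosed : IsClosed {y : H | ‖T y‖ ≤ t * ‖y‖} :=
    isClosed_le (by fun_prop) (by fun_prop)
  refine closure_minimal (fun y hy => ?_) hclosed hxcl
  obtain ⟨J, v, hxv, hn, hq⟩ := exists_sum_of_mem_iSup_eigenspace hsym hy
  rw [re_inner_adjoint_comp] at hq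
  have h1 : ‖T y‖ ^ 2 ≤ (t * ‖y‖) ^ 2 := by
    rw [hq, mul_pow, hn, Finset.mul_sum]
    refine Finset.sum_le_sum fun μ _ => ?_
    have := Set.mem_Iic.1 μ.2
    gcongr
  exact le_of_sq_le_sq h1 (by positivity)

theorem apx_of_singCount_le {T : H →L[ℂ] G} (hT : IsCompactOperator T) {t : ℝ} (ht : 0 ≤ t)
    {k : ℕ} (h : singCount t T ≤ k) : Apx T k t := by
  have hr : Module.rank ℂ (upperSpan t T) ≤ (k : Cardinal) := Cardinal.toENat_le_natCast.1 h
  have hfin : FiniteDimensional ℂ (upperSpan t T) :=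
    Module.rank_lt_aleph0_iff.1 (lt_of_le_of_lt hr (Cardinal.natCast_lt_aleph0 (n := k)))
  refine ⟨(T ∘L (upperSpan t T).subtypeL) ∘L (upperSpan t T).orthogonalProjectionOnto, ?_, ?_⟩
  · refine rank_comp_le_nat_left ?_
    have h := lift_rank_range_le
      ((T ∘L (upperSpan t T).subtypeL : upperSpan t T →L[ℂ] G) : upperSpan t T →ₗ[ℂ] G)
    rw [← Cardinal.lift_le_nat_iff]
    exact h.trans (Cardinal.lift_le_nat_iff.2 hr)
  · refine ContinuousLinearMap.opNorm_le_bound _ ht fun x => ?_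
    have h1 : (T - (T ∘L (upperSpan t T).subtypeL) ∘L (upperSpan t T).orthogonalProjectionOnto) x
        = T (x - (upperSpan t T).starProjection x) := by
      simp
    rw [h1]
    refine (norm_apply_le_of_mem_orthogonal hT ht
      (Submodule.sub_starProjection_mem_orthogonal x)).trans ?_
    refine mul_le_mul_of_nonneg_left ?_ ht
    have h2 : x - (upperSpan t T).starProjection x = (upperSpan t T)ᗮ.starProjection x := by
      rw [Submodule.starProjection_orthogonal]; simp
    rw [h2]
    exact Submodule.norm_starProjection_apply_le _ x

end Spectral

end SignSep

namespace SignSep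

/-! ### Asymptotic rank bounds and their calculus -/

section CountLE

variable {H G K : Type*}
  [NormedAddCommGroup H] [InnerProductSpace ℂ H]
  [NormedAddCommGroup G] [InnerProductSpace ℂ G]
  [NormedAddCommGroup K] [InnerProductSpace ℂ K]

/-- For all small `t > 0`, `T` is within `t` of an operator of rank at most `C * t ^ (-θ)`. -/
def CountLE (θ C : ℝ) (T : H →L[ℂ] G) : Prop :=
  ∀ᶠ t : ℝ in 𝓝[>] 0, ∃ k : ℕ, t ^ θ * k ≤ C ∧ Apx T k t

theorem CountLE.mono {θ C D : ℝ} {T : H →L[ℂ] G} (h : CountLE θ C T) (hCD : C ≤ D) :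
    CountLE θ D T :=
  Filter.Eventually.mono h fun _ ⟨k, hk, ha⟩ => ⟨k, hk.trans hCD, ha⟩

theorem eventually_mul_nhdsGT_zero {p : ℝ → Prop} (h : ∀ᶠ t : ℝ in 𝓝[>] 0, p t) {c : ℝ}
    (hc : 0 < c) : ∀ᶠ t : ℝ in 𝓝[>] 0, p (c * t) := by
  obtain ⟨r, hr, hp⟩ := mem_nhdsGT_iff_exists_Ioo_subset.1 h
  have : Set.Ioo (0 : ℝ) (r / c) ∈ 𝓝[>] (0 : ℝ) :=
    Ioo_mem_nhdsGT (div_pos hr hc)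
  filter_upwards [this] with t ht
  refine hp ⟨mul_pos hc ht.1, ?_⟩
  rw [mul_comm]
  exact (lt_div_iff₀ hc).1 ht.2

theorem eventually_sqrt_nhdsGT_zero {p : ℝ → Prop} (h : ∀ᶠ t : ℝ in 𝓝[>] 0, p t) :
    ∀ᶠ t : ℝ in 𝓝[>] 0, p (√t) := by
  obtain ⟨r, hr, hp⟩ := mem_nhdsGT_iff_exists_Ioo_subset.1 h
  have hr : 0 < r := hr
  have : Set.Ioo (0 : ℝ) (r ^ 2) ∈ 𝓝[>] (0 : ℝ) := Ioo_mem_nhdsGT (by positivity)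
  filter_upwards [this] with t ht
  exact hp ⟨Real.sqrt_pos.2 ht.1, (Real.sqrt_lt' hr).2 ht.2⟩

theorem isCompactOperator_of_countLE [CompleteSpace G] {θ C : ℝ} {T : H →L[ℂ] G}
    (h : CountLE θ C T) : IsCompactOperator T := by
  refine isCompactOperator_of_apx fun t ht => ?_
  obtain ⟨s, ⟨k, _, hk⟩, hs⟩ := (h.and (Ioo_mem_nhdsGT ht)).exists
  exact ⟨k, hk.mono le_rfl hs.2.le⟩

theorem CountLE.add {θ C D : ℝ} {S T : H →L[ℂ] G} (hS : CountLE θ C S) (hT : CountLE θ D T) :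
    CountLE θ (2 ^ θ * (C + D)) (S + T) := by
  have h := eventually_mul_nhdsGT_zero (Filter.Eventually.and hS hT) (c := 1 / 2) (by norm_num)
  filter_upwards [h, self_mem_nhdsWithin] with t ht h0
  have h0 : 0 < t := h0
  obtain ⟨⟨k, hk, hak⟩, ⟨l, hl, hal⟩⟩ := ht
  refine ⟨k + l, ?_, (hak.add hal).mono le_rfl (by linarith)⟩
  have h2 : t ^ θ = 2 ^ θ * (1 / 2 * t) ^ θ := by
    rw [← Real.mul_rpow (by norm_num) (by positivity)]; congr 1; ring
  rw [h2, mul_assoc]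
  push_cast
  gcongr
  linarith

theorem CountLE.comp_left {θ C b : ℝ} {T : H →L[ℂ] G} (hT : CountLE θ C T) (hb : 0 < b)
    {B : G →L[ℂ] K} (hB : ‖B‖ ≤ b) : CountLE θ (b ^ θ * C) (B ∘L T) := by
  filter_upwards [eventually_mul_nhdsGT_zero hT (inv_pos.2 hb), self_mem_nhdsWithin] with t ht h0
  have h0 : 0 < t := h0
  obtain ⟨k, hk, ha⟩ := ht
  refine ⟨k, ?_, (ha.comp_left hB).mono le_rfl (by rw [mul_inv_cancel_left₀ hb.ne'])⟩
  have h2 : t ^ θ = b ^ θ * (b⁻¹ * t) ^ θ := by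
    rw [← Real.mul_rpow hb.le (by positivity), mul_inv_cancel_left₀ hb.ne']
  rw [h2, mul_assoc]
  gcongr

theorem CountLE.comp_right {θ C b : ℝ} {T : G →L[ℂ] K} (hT : CountLE θ C T) (hb : 0 < b)
    {B : H →L[ℂ] G} (hB : ‖B‖ ≤ b) : CountLE θ (b ^ θ * C) (T ∘L B) := by
  filter_upwards [eventually_mul_nhdsGT_zero hT (inv_pos.2 hb), self_mem_nhdsWithin] with t ht h0
  have h0 : 0 < t := h0
  obtain ⟨k, hk, ha⟩ := ht
  refine ⟨k, ?_, (ha.comp_right hB).mono le_rfl (by rw [mul_comm, mul_inv_cancel_left₀ hb.ne'])⟩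
  have h2 : t ^ θ = b ^ θ * (b⁻¹ * t) ^ θ := by
    rw [← Real.mul_rpow hb.le (by positivity), mul_inv_cancel_left₀ hb.ne']
  rw [h2, mul_assoc]
  gcongr

theorem CountLE.adjoint [CompleteSpace H] [CompleteSpace G] {θ C : ℝ} {T : H →L[ℂ] G}
    (hT : CountLE θ C T) : CountLE θ C T.adjoint :=
  Filter.Eventually.mono hT fun _ ⟨k, hk, ha⟩ => ⟨k, hk, ha.adjoint⟩

/-- Split `t = (√t / η) (η √t)` between the two factors. The free parameter `η` balances the
constants, so that a factor with arbitrarily small constant makes the product's constant small. -/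
theorem CountLE.comp {θ C D η : ℝ} {S : G →L[ℂ] K} {T : H →L[ℂ] G} (hS : CountLE (2 * θ) C S)
    (hT : CountLE (2 * θ) D T) (hη : 0 < η) :
    CountLE θ (η ^ (2 * θ) * C + (η⁻¹) ^ (2 * θ) * D) (S ∘L T) := by
  have h := eventually_sqrt_nhdsGT_zero ((eventually_mul_nhdsGT_zero hS (inv_pos.2 hη)).and
    (eventually_mul_nhdsGT_zero hT hη))
  filter_upwards [h, self_mem_nhdsWithin] with t ht h0
  have h0 : 0 < t := h0
  have hs : 0 < √t := Real.sqrt_pos.2 h0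
  obtain ⟨⟨k, hk, hak⟩, ⟨l, hl, hal⟩⟩ := ht
  have hst : t = √t ^ (2 : ℝ) := by
    rw [Real.rpow_two, Real.sq_sqrt h0.le]
  refine ⟨k + l, ?_, (hak.comp hal).mono le_rfl ?_⟩
  · have h1 : t ^ θ = η ^ (2 * θ) * (η⁻¹ * √t) ^ (2 * θ) := by
      rw [← Real.mul_rpow hη.le (by positivity), mul_inv_cancel_left₀ hη.ne']
      nth_rw 1 [hst]
      rw [← Real.rpow_mul hs.le]
    have h2 : t ^ θ = (η⁻¹) ^ (2 * θ) * (η * √t) ^ (2 * θ) := by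
      rw [← Real.mul_rpow (by positivity) (by positivity), inv_mul_cancel_left₀ hη.ne']
      nth_rw 1 [hst]
      rw [← Real.rpow_mul hs.le]
    push_cast
    rw [mul_add]
    nth_rw 1 [h1]
    rw [h2, mul_assoc, mul_assoc]
    gcongr
  · have : η⁻¹ * √t * (η * √t) = √t ^ 2 := by field_simp
    rw [this, Real.sq_sqrt h0.le]

theorem CountLE.nonneg {θ C : ℝ} {T : H →L[ℂ] G} (h : CountLE θ C T) : 0 ≤ C := by
  obtain ⟨t, ⟨k, hk, _⟩, h0⟩ := (Filter.Eventually.and h self_mem_nhdsWithin).exists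
  have h0 : 0 < t := h0
  exact le_trans (by positivity) hk

end CountLE

/-! ### The weak Schatten ideals and their separable parts -/

section Ideals

variable {H G K : Type*}
  [NormedAddCommGroup H] [InnerProductSpace ℂ H] [CompleteSpace H]
  [NormedAddCommGroup G] [InnerProductSpace ℂ G] [CompleteSpace G]
  [NormedAddCommGroup K] [InnerProductSpace ℂ K] [CompleteSpace K]

theorem countLE_of_upperCoeff_lt {θ C : ℝ} {T : H →L[ℂ] G} (hT : IsCompactOperator T)
    (hC : 0 ≤ C) (h : upperCoeff θ T < ENNReal.ofReal C) : CountLE θ C T := by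
  have h1 := Filter.eventually_lt_of_limsup_lt h
  filter_upwards [h1, self_mem_nhdsWithin] with t ht h0
  have h0 : 0 < t := h0
  have hp : 0 < t ^ θ := Real.rpow_pos_of_pos h0 θ
  cases hn : singCount t T with
  | top =>
    rw [hn, ENat.toENNReal_top, ENNReal.mul_top (by simpa using hp)] at ht
    exact absurd ht (by simp)
  | coe k =>
    refine ⟨k, ?_, apx_of_singCount_le hT h0.le hn.le⟩
    rw [hn, ENat.toENNReal_coe, ← ENNReal.ofReal_natCast, ← ENNReal.ofReal_mul hp.le] at ht
    exact (ENNReal.ofReal_le_ofReal_iff hC).1 ht.le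

theorem upperCoeff_le_of_countLE {θ C : ℝ} {T : H →L[ℂ] G} (h : CountLE θ C T) :
    upperCoeff θ T ≤ ENNReal.ofReal C := by
  refine Filter.limsup_le_of_le (by isBoundedDefault) ?_
  filter_upwards [h, self_mem_nhdsWithin] with t ht h0
  have h0 : 0 < t := h0
  obtain ⟨k, hk, ha⟩ := ht
  have hp : 0 < t ^ θ := Real.rpow_pos_of_pos h0 θ
  calc ENNReal.ofReal (t ^ θ) * ((singCount t T : ℕ∞) : ℝ≥0∞)
      ≤ ENNReal.ofReal (t ^ θ) * (((k : ℕ∞)) : ℝ≥0∞) := by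
        gcongr
        exact singCount_le_of_apx ha
    _ = ENNReal.ofReal (t ^ θ * k) := by
        rw [ENNReal.ofReal_mul hp.le, ENat.toENNReal_coe, ENNReal.ofReal_natCast]
    _ ≤ ENNReal.ofReal C := ENNReal.ofReal_le_ofReal hk

theorem mem_weakSchatten_iff {θ : ℝ} {T : H →L[ℂ] G} :
    T ∈ weakSchatten θ ↔ ∃ C, CountLE θ C T := by
  constructor
  · rintro ⟨hT, h⟩
    refine ⟨(upperCoeff θ T).toReal + 1, countLE_of_upperCoeff_lt hT (by positivity) ?_⟩
    rw [ENNReal.ofReal_add (by positivity) (by norm_num), ENNReal.ofReal_toReal h.ne]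
    simpa using ENNReal.lt_add_right h.ne one_ne_zero
  · rintro ⟨C, h⟩
    exact ⟨isCompactOperator_of_countLE h,
      (upperCoeff_le_of_countLE h).trans_lt ENNReal.ofReal_lt_top⟩

theorem mem_weakSchattenZero_iff {θ : ℝ} {T : H →L[ℂ] G} :
    T ∈ weakSchattenZero θ ↔ ∀ ε : ℝ, 0 < ε → CountLE θ ε T := by
  constructor
  · rintro ⟨hT, h⟩ ε hε
    exact countLE_of_upperCoeff_lt hT hε.le (by rw [h]; simpa using hε)
  · intro h
    refine ⟨isCompactOperator_of_countLE (h 1 one_pos), ?_⟩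
    rw [← nonpos_iff_eq_zero]
    refine ENNReal.le_of_forall_pos_le_add fun ε hε _ => ?_
    simpa using upperCoeff_le_of_countLE (h ε hε)

theorem weakSchatten_comp_left {θ : ℝ} {T : H →L[ℂ] G} (hT : T ∈ weakSchatten θ)
    (B : G →L[ℂ] K) : B ∘L T ∈ weakSchatten θ := by
  obtain ⟨C, h⟩ := mem_weakSchatten_iff.1 hT
  exact mem_weakSchatten_iff.2 ⟨_, h.comp_left (b := ‖B‖ + 1) (by positivity) (by linarith)⟩

theorem weakSchatten_adjoint {θ : ℝ} {T : H →L[ℂ] G} (hT : T ∈ weakSchatten θ) :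
    T.adjoint ∈ weakSchatten θ := by
  obtain ⟨C, h⟩ := mem_weakSchatten_iff.1 hT
  exact mem_weakSchatten_iff.2 ⟨_, h.adjoint⟩

theorem weakSchatten_comp {θ : ℝ} {S : G →L[ℂ] K} {T : H →L[ℂ] G}
    (hS : S ∈ weakSchatten (2 * θ)) (hT : T ∈ weakSchatten (2 * θ)) :
    S ∘L T ∈ weakSchatten θ := by
  obtain ⟨C, h⟩ := mem_weakSchatten_iff.1 hS
  obtain ⟨D, h'⟩ := mem_weakSchatten_iff.1 hT
  exact mem_weakSchatten_iff.2 ⟨_, h.comp h' one_pos⟩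

theorem weakSchattenZero_add {θ : ℝ} {S T : H →L[ℂ] G} (hS : S ∈ weakSchattenZero θ)
    (hT : T ∈ weakSchattenZero θ) : S + T ∈ weakSchattenZero θ := by
  rw [mem_weakSchattenZero_iff] at *
  intro ε hε
  have hp : (0 : ℝ) < 2 ^ θ := by positivity
  refine ((hS (ε / 2 ^ θ / 2) (by positivity)).add (hT (ε / 2 ^ θ / 2) (by positivity))).mono ?_
  apply le_of_eq
  field_simp
  ring

theorem weakSchattenZero_comp_left {θ : ℝ} {T : H →L[ℂ] G} (hT : T ∈ weakSchattenZero θ)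
    (B : G →L[ℂ] K) : B ∘L T ∈ weakSchattenZero θ := by
  rw [mem_weakSchattenZero_iff] at *
  intro ε hε
  have hp : 0 < (‖B‖ + 1) ^ θ := by positivity
  refine ((hT (ε / (‖B‖ + 1) ^ θ) (by positivity)).comp_left (B := B) (b := ‖B‖ + 1)
    (by positivity) (by linarith)).mono (le_of_eq ?_)
  field_simp

theorem weakSchattenZero_adjoint {θ : ℝ} {T : H →L[ℂ] G} (hT : T ∈ weakSchattenZero θ) :
    T.adjoint ∈ weakSchattenZero θ := by
  rw [mem_weakSchattenZero_iff] at *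
  exact fun ε hε => (hT ε hε).adjoint

theorem weakSchattenZero_comp_right {θ : ℝ} {T : G →L[ℂ] K} (hT : T ∈ weakSchattenZero θ)
    (B : H →L[ℂ] G) : T ∘L B ∈ weakSchattenZero θ := by
  have h := weakSchattenZero_adjoint (weakSchattenZero_comp_left (weakSchattenZero_adjoint hT)
    B.adjoint)
  rwa [ContinuousLinearMap.adjoint_comp, ContinuousLinearMap.adjoint_adjoint,
    ContinuousLinearMap.adjoint_adjoint] at h

theorem weakSchattenZero_smul {θ : ℝ} {T : H →L[ℂ] G} (hT : T ∈ weakSchattenZero θ) (c : ℂ) :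
    c • T ∈ weakSchattenZero θ := by
  have h := weakSchattenZero_comp_left hT (c • ContinuousLinearMap.id ℂ G)
  rwa [ContinuousLinearMap.smul_comp, ContinuousLinearMap.id_comp] at h

theorem weakSchattenZero_sub {θ : ℝ} {S T : H →L[ℂ] G} (hS : S ∈ weakSchattenZero θ)
    (hT : T ∈ weakSchattenZero θ) : S - T ∈ weakSchattenZero θ := by
  have h := weakSchattenZero_add hS (weakSchattenZero_smul hT (-1))
  rwa [neg_one_smul, ← sub_eq_add_neg] at h

theorem weakSchattenZero_comp_of_mem_left {θ : ℝ} (hθ : 0 < θ) {S : G →L[ℂ] K} {T : H →L[ℂ] G}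
    (hS : S ∈ weakSchatten (2 * θ)) (hT : T ∈ weakSchattenZero (2 * θ)) :
    S ∘L T ∈ weakSchattenZero θ := by
  obtain ⟨C, h⟩ := mem_weakSchatten_iff.1 hS
  have hC := h.nonneg
  rw [mem_weakSchattenZero_iff] at *
  intro ε hε
  -- Chosen so that the bounded factor contributes at most `ε / 2`; the constant of `T` is then
  -- taken small enough, depending on `η`, for the other half.
  set η : ℝ := (ε / 2 / (C + 1)) ^ (2 * θ)⁻¹ with hη
  have hη0 : 0 < η := by positivity
  have h1 : η ^ (2 * θ) = ε / 2 / (C + 1) :=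
    Real.rpow_inv_rpow (by positivity) (by positivity)
  have h2 : η⁻¹ ^ (2 * θ) = (C + 1) * 2 / ε := by
    rw [Real.inv_rpow hη0.le, h1]; field_simp
  refine (h.comp (hT (ε / 2 / ((C + 1) * 2 / ε)) (by positivity)) hη0).mono ?_
  rw [h1, h2, mul_div_cancel₀ _ (by positivity)]
  have : ε / 2 / (C + 1) * C ≤ ε / 2 := by
    rw [div_mul_eq_mul_div, div_le_iff₀ (by positivity)]
    nlinarith
  linarith

theorem weakSchattenZero_comp_of_mem_right {θ : ℝ} (hθ : 0 < θ) {S : G →L[ℂ] K}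
    {T : H →L[ℂ] G} (hS : S ∈ weakSchattenZero (2 * θ)) (hT : T ∈ weakSchatten (2 * θ)) :
    S ∘L T ∈ weakSchattenZero θ := by
  have h := weakSchattenZero_adjoint (weakSchattenZero_comp_of_mem_left hθ
    (weakSchatten_adjoint hT) (weakSchattenZero_adjoint hS))
  rwa [ContinuousLinearMap.adjoint_comp, ContinuousLinearMap.adjoint_adjoint,
    ContinuousLinearMap.adjoint_adjoint] at h

end Ideals

end SignSep

namespace SignSep

/-! ### Scalar estimates for products of Cayley functions -/

section Cayley

/-- The Cayley-type function `(x - p) / (x + p)`. -/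
noncomputable def cayley (p x : ℝ) : ℝ := (x - p) / (x + p)

/-- Product of powers of Cayley functions with the shifts `τ * 4 ^ i`. -/
noncomputable def cayleyProd (τ : ℝ) (n : ℕ) (x : ℝ) : ℝ :=
  ∏ i ∈ Finset.range n, cayley (τ * 4 ^ i) x ^ (3 * (i + 1))

/-- Continuous functions on the half-line bounded by one. -/
def IsContr (f : ℝ → ℝ) : Prop := ContinuousOn f (Set.Ici 0) ∧ ∀ x, 0 ≤ x → |f x| ≤ 1

theorem isContr_cayley {p : ℝ} (hp : 0 < p) : IsContr (cayley p) := by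
  constructor
  · unfold cayley
    exact ContinuousOn.div (by fun_prop) (by fun_prop) fun x hx => by
      have : (0 : ℝ) ≤ x := hx
      positivity
  · intro x hx
    rw [cayley, abs_div, abs_of_pos (by positivity : 0 < x + p), div_le_one (by positivity)]
    exact abs_sub_le_iff.2 ⟨by linarith, by linarith⟩

theorem isContr_one : IsContr (fun _ => 1) := ⟨by fun_prop, by simp⟩

theorem IsContr.mul {f g : ℝ → ℝ} (hf : IsContr f) (hg : IsContr g) :
    IsContr (fun x => f x * g x) := by
  refine ⟨hf.1.mul hg.1, fun x hx => ?_⟩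
  rw [abs_mul]
  exact mul_le_one₀ (hf.2 x hx) (abs_nonneg _) (hg.2 x hx)

theorem IsContr.pow {f : ℝ → ℝ} (hf : IsContr f) (n : ℕ) : IsContr (fun x => f x ^ n) := by
  refine ⟨hf.1.pow n, fun x hx => ?_⟩
  rw [abs_pow]
  exact pow_le_one₀ (abs_nonneg _) (hf.2 x hx)

theorem isContr_cayleyProd {τ : ℝ} (hτ : 0 < τ) (n : ℕ) : IsContr (cayleyProd τ n) := by
  induction n with
  | zero =>
    have : cayleyProd τ 0 = fun _ => 1 := by funext x; simp [cayleyProd]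
    rw [this]
    exact isContr_one
  | succ n ih =>
    have h := ih.mul ((isContr_cayley (p := τ * 4 ^ n) (by positivity)).pow (3 * (n + 1)))
    have : cayleyProd τ (n + 1)
        = fun x => cayleyProd τ n x * cayley (τ * 4 ^ n) x ^ (3 * (n + 1)) := by
      funext x; simp [cayleyProd, Finset.prod_range_succ]
    rwa [this]

/-- Each new factor must handle only `(τ 4^n, τ 4^(n+1)]`, where its Cayley function is at most
`3/5`; the power `3(n+1)` beats the growth `4^(n+1)` of `x`. On the older interval it does no harm,
being a contraction. -/
theorem abs_mul_cayleyProd_le {τ : ℝ} (hτ : 0 < τ) (n : ℕ) :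
    ∀ x, 0 ≤ x → x ≤ τ * 4 ^ n → |x * cayleyProd τ n x| ≤ τ := by
  induction n with
  | zero =>
    intro x hx h
    rw [abs_of_nonneg (by simpa [cayleyProd] using hx)]
    simpa [cayleyProd] using h
  | succ n ih =>
    intro x hx h
    have hs : cayleyProd τ (n + 1) x
        = cayleyProd τ n x * cayley (τ * 4 ^ n) x ^ (3 * (n + 1)) := by
      simp [cayleyProd, Finset.prod_range_succ]
    rw [hs]
    have hp : 0 < τ * 4 ^ n := by positivity
    rcases le_or_gt x (τ * 4 ^ n) with h1 | h1
    · have h2 := ((isContr_cayley hp).pow (3 * (n + 1))).2 x hx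
      rw [← mul_assoc, abs_mul]
      exact (mul_le_of_le_one_right (abs_nonneg _) h2).trans (ih x hx h1)
    · have h2 := (isContr_cayleyProd hτ n).2 x hx
      have h3 : |cayley (τ * 4 ^ n) x| ≤ 3 / 5 := by
        rw [pow_succ] at h
        rw [cayley, abs_of_nonneg (div_nonneg (by linarith) (by linarith)),
          div_le_div_iff₀ (by linarith) (by norm_num)]
        linarith
      have h4 : |cayley (τ * 4 ^ n) x ^ (3 * (n + 1))| ≤ (1 / 4) ^ (n + 1) := by
        rw [abs_pow, pow_mul]
        refine pow_le_pow_left₀ (by positivity) ?_ _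
        calc |cayley (τ * 4 ^ n) x| ^ 3 ≤ (3 / 5) ^ 3 := pow_le_pow_left₀ (abs_nonneg _) h3 3
          _ ≤ 1 / 4 := by norm_num
      rw [abs_mul, abs_mul, abs_of_nonneg hx]
      calc x * (|cayleyProd τ n x| * |cayley (τ * 4 ^ n) x ^ (3 * (n + 1))|)
          ≤ (τ * 4 ^ (n + 1)) * (1 * (1 / 4) ^ (n + 1)) := by gcongr
        _ = τ := by
          rw [one_mul, mul_assoc, ← mul_pow]; norm_num

end Cayley

/-! ### Cayley functions of non-negative operators -/

section FunctionalCalculus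

variable {H : Type*} [NormedAddCommGroup H] [InnerProductSpace ℂ H] [CompleteSpace H]

theorem spectrum_subset_Ici {a : H →L[ℂ] H} (ha : 0 ≤ a) : spectrum ℝ a ⊆ Set.Ici 0 :=
  fun _ hx => spectrum_nonneg_of_nonneg ha hx

theorem le_norm_of_mem_spectrum {a : H →L[ℂ] H} {x : ℝ} (hx : x ∈ spectrum ℝ a) : x ≤ ‖a‖ := by
  have h := spectrum.norm_le_norm_mul_of_mem hx
  have h1 : ‖(1 : H →L[ℂ] H)‖ ≤ 1 := ContinuousLinearMap.norm_id_le
  exact (le_abs_self x).trans (h.trans (mul_le_of_le_one_right (norm_nonneg _) h1))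

theorem IsContr.norm_cfc_le {f : ℝ → ℝ} (hf : IsContr f) {a : H →L[ℂ] H} (ha : 0 ≤ a) :
    ‖cfc f a‖ ≤ 1 :=
  _root_.norm_cfc_le zero_le_one fun x hx => hf.2 x (spectrum_subset_Ici ha hx)

theorem norm_cfc_div_le {f : ℝ → ℝ} (hf : IsContr f) {a : H →L[ℂ] H} (ha : 0 ≤ a) {p : ℝ}
    (hp : 0 < p) : ‖cfc (fun x => f x / (x + p)) a‖ ≤ p⁻¹ := by
  refine _root_.norm_cfc_le (by positivity) fun x hx => ?_
  have hx0 : 0 ≤ x := spectrum_subset_Ici ha hx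
  rw [Real.norm_eq_abs, abs_div, abs_of_pos (by positivity : 0 < x + p), ← one_div]
  exact div_le_div₀ zero_le_one (hf.2 x hx0) hp (by linarith)

theorem continuousOn_div_add {f : ℝ → ℝ} (hf : IsContr f) {a : H →L[ℂ] H} (ha : 0 ≤ a) {p : ℝ}
    (hp : 0 < p) : ContinuousOn (fun x => f x / (x + p)) (spectrum ℝ a) :=
  ContinuousOn.div (hf.1.mono (spectrum_subset_Ici ha)) (by fun_prop) fun x hx => by
    have : 0 ≤ x := spectrum_subset_Ici ha hx
    positivity

theorem cfc_eq_div_add {f : ℝ → ℝ} (hf : IsContr f) {a : H →L[ℂ] H} (ha : 0 ≤ a) {p : ℝ}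
    (hp : 0 < p) : cfc f a = cfc (fun x => f x / (x + p)) a * (a + algebraMap ℝ _ p) := by
  have hc := continuousOn_div_add hf ha hp
  have hsa : IsSelfAdjoint a := .of_nonneg ha
  have h1 : a + algebraMap ℝ _ p = cfc (fun x : ℝ => x + p) a := by
    rw [cfc_add (fun x : ℝ => x) (fun _ => p) (a := a), cfc_id' ℝ a, cfc_const p a]
  rw [h1, ← cfc_mul _ _ _ hc (by fun_prop)]
  refine cfc_congr fun x hx => ?_
  have : 0 ≤ x := spectrum_subset_Ici ha hx
  have : x + p ≠ 0 := by positivity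
  field_simp

theorem cfc_cayley_eq {f : ℝ → ℝ} (hf : IsContr f) {a : H →L[ℂ] H} (ha : 0 ≤ a) {p : ℝ}
    (hp : 0 < p) : cfc (fun x => f x * cayley p x) a
      = cfc (fun x => f x / (x + p)) a * (a - algebraMap ℝ _ p) := by
  have hc := continuousOn_div_add hf ha hp
  have hsa : IsSelfAdjoint a := .of_nonneg ha
  have h1 : a - algebraMap ℝ _ p = cfc (fun x : ℝ => x - p) a := by
    rw [cfc_sub _ _ a, cfc_id' ℝ a, cfc_const p a]
  rw [h1, ← cfc_mul _ _ _ hc (by fun_prop)]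
  refine cfc_congr fun x hx => ?_
  have : 0 ≤ x := spectrum_subset_Ici ha hx
  have : x + p ≠ 0 := by positivity
  simp only [cayley]
  ring

theorem cfc_mul_comm_add {g : ℝ → ℝ} {a : H →L[ℂ] H} (c : ℝ) :
    cfc g a * (a + algebraMap ℝ _ c) = (a + algebraMap ℝ _ c) * cfc g a := by
  have h1 : Commute a (cfc g a) := by
    by_cases hsa : IsSelfAdjoint a
    · simpa only [cfc_id ℝ a] using cfc_commute_cfc id g a
    · rw [cfc_apply_of_not_predicate a hsa]
      exact Commute.zero_right a
  rw [mul_add, add_mul, h1.eq, Algebra.commutes]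

theorem norm_mul_cfc_cayleyProd_le {a : H →L[ℂ] H} (ha : 0 ≤ a) {τ : ℝ} (hτ : 0 < τ) {n : ℕ}
    (hn : ‖a‖ ≤ τ * 4 ^ n) : ‖cfc (cayleyProd τ n) a * a‖ ≤ τ ∧
      ‖a * cfc (cayleyProd τ n) a‖ ≤ τ := by
  have hsa : IsSelfAdjoint a := .of_nonneg ha
  have hc : ContinuousOn (cayleyProd τ n) (spectrum ℝ a) :=
    (isContr_cayleyProd hτ n).1.mono (spectrum_subset_Ici ha)
  have h0 : ∀ x ∈ spectrum ℝ a, |x * cayleyProd τ n x| ≤ τ := fun x hx =>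
    abs_mul_cayleyProd_le hτ n x (spectrum_subset_Ici ha hx) ((le_norm_of_mem_spectrum hx).trans hn)
  have h1 : a * cfc (cayleyProd τ n) a = cfc (fun x => x * cayleyProd τ n x) a := by
    rw [cfc_mul _ _ _ (by fun_prop) hc, cfc_id' ℝ a]
  have h2 : cfc (cayleyProd τ n) a * a = cfc (fun x => x * cayleyProd τ n x) a := by
    have : (fun x => x * cayleyProd τ n x) = fun x => cayleyProd τ n x * x := by
      funext x; ring
    rw [this, cfc_mul _ _ _ hc (by fun_prop), cfc_id' ℝ a]
  rw [h1, h2, and_self]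
  exact norm_cfc_le hτ.le h0

end FunctionalCalculus

/-! ### Alternating direction iteration for the Sylvester equation -/

section Sylvester

variable {H G : Type*}
  [NormedAddCommGroup H] [InnerProductSpace ℂ H] [CompleteSpace H]
  [NormedAddCommGroup G] [InnerProductSpace ℂ G] [CompleteSpace G]

/-- One step of the alternating direction iteration for `a X + X b = K`. -/
theorem sylvester_step {a : G →L[ℂ] G} {b : H →L[ℂ] H} (ha : 0 ≤ a) (hb : 0 ≤ b)
    {X K : H →L[ℂ] G} (hK : a ∘L X + X ∘L b = K) {f : ℝ → ℝ} (hf : IsContr f) {p : ℝ}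
    (hp : 0 < p) :
    cfc f a ∘L X ∘L cfc f b
        - cfc (fun x => f x * cayley p x) a ∘L X ∘L cfc (fun x => f x * cayley p x) b
      = ((2 * p : ℝ) : ℂ) •
        (cfc (fun x => f x / (x + p)) a ∘L K ∘L cfc (fun x => f x / (x + p)) b) := by
  -- Once the linear factors in `b` are moved next to `X`, the claim is `(a+p)X(b+p) - (a-p)X(b-p) =
  -- 2p(aX + Xb)` between the outer factors. Writing `b - p` as `b + (-p)` lets one commutation
  -- lemma serve both terms.
  rw [cfc_eq_div_add hf ha hp, cfc_eq_div_add hf hb hp, cfc_cayley_eq hf ha hp,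
    cfc_cayley_eq hf hb hp, sub_eq_add_neg b, ← map_neg, cfc_mul_comm_add (a := b),
    cfc_mul_comm_add (a := b), ← hK]
  ext x
  simp [Algebra.algebraMap_eq_smul_one]
  module

theorem sylvester_step_apx {a : G →L[ℂ] G} {b : H →L[ℂ] H} (ha : 0 ≤ a) (hb : 0 ≤ b)
    {X K : H →L[ℂ] G} (hK : a ∘L X + X ∘L b = K) {f : ℝ → ℝ} (hf : IsContr f) {p : ℝ}
    (hp : 0 < p) {k : ℕ} {δ : ℝ} (h : Apx K k δ) :
    Apx (cfc f a ∘L X ∘L cfc f b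
        - cfc (fun x => f x * cayley p x) a ∘L X ∘L cfc (fun x => f x * cayley p x) b)
      k (2 * δ / p) := by
  rw [sylvester_step ha hb hK hf hp]
  have h1 := ((h.comp_right (norm_cfc_div_le hf hb hp)).comp_left (norm_cfc_div_le hf ha hp))
  have h2 := h1.comp_left (B := ((2 * p : ℝ) : ℂ) • ContinuousLinearMap.id ℂ G) (b := 2 * p) (by
    rw [norm_smul, Complex.norm_real, Real.norm_of_nonneg (by positivity)]
    exact mul_le_of_le_one_right (by positivity) ContinuousLinearMap.norm_id_le)
  rw [ContinuousLinearMap.smul_comp, ContinuousLinearMap.id_comp] at h2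
  refine h2.mono le_rfl (le_of_eq ?_)
  field_simp

theorem sylvester_pow_apx {a : G →L[ℂ] G} {b : H →L[ℂ] H} (ha : 0 ≤ a) (hb : 0 ≤ b)
    {X K : H →L[ℂ] G} (hK : a ∘L X + X ∘L b = K) {f : ℝ → ℝ} (hf : IsContr f) {p : ℝ}
    (hp : 0 < p) {k : ℕ} {δ : ℝ} (h : Apx K k δ) (n : ℕ) :
    Apx (cfc f a ∘L X ∘L cfc f b
        - cfc (fun x => f x * cayley p x ^ n) a ∘L X ∘L cfc (fun x => f x * cayley p x ^ n) b)
      (n * k) (n * (2 * δ / p)) := by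
  induction n with
  | zero => simpa using apx_of_norm_le (T := (0 : H →L[ℂ] G)) (t := 0) (by simp)
  | succ n ih =>
    have h1 := ih.add (sylvester_step_apx ha hb hK (hf.mul ((isContr_cayley hp).pow n)) hp h)
    rw [sub_add_sub_cancel] at h1
    simp only [mul_assoc, ← pow_succ] at h1 ⊢
    refine h1.mono (by ring_nf; exact le_rfl) (by push_cast; ring_nf; exact le_rfl)

/-- The steps telescope, and every shift may use its own approximation of `K`. This freedom drives
the square root estimate: larger shifts tolerate larger errors, hence smaller ranks. -/
theorem sylvester_prod_apx {a : G →L[ℂ] G} {b : H →L[ℂ] H} (ha : 0 ≤ a) (hb : 0 ≤ b)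
    {X K : H →L[ℂ] G} (hK : a ∘L X + X ∘L b = K) {τ : ℝ} (hτ : 0 < τ) {k : ℕ → ℕ} {δ : ℕ → ℝ}
    (h : ∀ i, Apx K (k i) (δ i)) (n : ℕ) :
    Apx (X - cfc (cayleyProd τ n) a ∘L X ∘L cfc (cayleyProd τ n) b)
      (∑ i ∈ Finset.range n, 3 * (i + 1) * k i)
      (∑ i ∈ Finset.range n, (3 * (i + 1) : ℕ) * (2 * δ i / (τ * 4 ^ i))) := by
  induction n with
  | zero =>
    have hsa : IsSelfAdjoint a := .of_nonneg ha
    have hsb : IsSelfAdjoint b := .of_nonneg hb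
    have h1 : cayleyProd τ 0 = fun _ => 1 := by funext x; simp [cayleyProd]
    rw [h1, cfc_const_one ℝ a, cfc_const_one ℝ b]
    have h2 : X - (1 : G →L[ℂ] G) ∘L X ∘L (1 : H →L[ℂ] H) = 0 := by ext x; simp
    rw [h2]
    simpa using apx_of_norm_le (T := (0 : H →L[ℂ] G)) (t := 0) (by simp)
  | succ n ih =>
    have h1 := ih.add (sylvester_pow_apx ha hb hK (isContr_cayleyProd hτ n)
      (p := τ * 4 ^ n) (by positivity) (h n) (3 * (n + 1)))
    rw [sub_add_sub_cancel] at h1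
    have h2 : cayleyProd τ (n + 1)
        = fun x => cayleyProd τ n x * cayley (τ * 4 ^ n) x ^ (3 * (n + 1)) := by
      funext x; simp [cayleyProd, Finset.prod_range_succ]
    rw [h2, Finset.sum_range_succ, Finset.sum_range_succ]
    exact h1

theorem sylvester_pow_mem {θ : ℝ} {a : G →L[ℂ] G} {b : H →L[ℂ] H} (ha : 0 ≤ a) (hb : 0 ≤ b)
    {X K : H →L[ℂ] G} (hK : a ∘L X + X ∘L b = K) (h : K ∈ weakSchattenZero θ)
    {f : ℝ → ℝ} (hf : IsContr f) {p : ℝ} (hp : 0 < p) (n : ℕ) :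
    cfc f a ∘L X ∘L cfc f b
        - cfc (fun x => f x * cayley p x ^ n) a ∘L X ∘L cfc (fun x => f x * cayley p x ^ n) b
      ∈ weakSchattenZero θ := by
  induction n with
  | zero => simpa using weakSchattenZero_smul h 0
  | succ n ih =>
    have h1 : cfc (fun x => f x * cayley p x ^ n) a ∘L X ∘L cfc (fun x => f x * cayley p x ^ n) b
        - cfc (fun x => f x * cayley p x ^ n * cayley p x) a ∘L X ∘L
          cfc (fun x => f x * cayley p x ^ n * cayley p x) b ∈ weakSchattenZero θ := by
      rw [sylvester_step ha hb hK (hf.mul ((isContr_cayley hp).pow n)) hp]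
      exact weakSchattenZero_smul
        (weakSchattenZero_comp_left (weakSchattenZero_comp_right h _) _) _
    have h2 := weakSchattenZero_add ih h1
    rw [sub_add_sub_cancel] at h2
    simpa only [mul_assoc, ← pow_succ] using h2

theorem sylvester_prod_mem {θ : ℝ} {a : G →L[ℂ] G} {b : H →L[ℂ] H} (ha : 0 ≤ a) (hb : 0 ≤ b)
    {X K : H →L[ℂ] G} (hK : a ∘L X + X ∘L b = K) (h : K ∈ weakSchattenZero θ)
    {τ : ℝ} (hτ : 0 < τ) (n : ℕ) :
    X - cfc (cayleyProd τ n) a ∘L X ∘L cfc (cayleyProd τ n) b ∈ weakSchattenZero θ := by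
  induction n with
  | zero =>
    have hsa : IsSelfAdjoint a := .of_nonneg ha
    have hsb : IsSelfAdjoint b := .of_nonneg hb
    have h1 : cayleyProd τ 0 = fun _ => 1 := by funext x; simp [cayleyProd]
    rw [h1, cfc_const_one ℝ a, cfc_const_one ℝ b]
    have h2 : X - (1 : G →L[ℂ] G) ∘L X ∘L (1 : H →L[ℂ] H) = (0 : ℂ) • K := by ext x; simp
    rw [h2]
    exact weakSchattenZero_smul h 0
  | succ n ih =>
    have h1 := weakSchattenZero_add ih (sylvester_pow_mem ha hb hK h (isContr_cayleyProd hτ n)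
      (p := τ * 4 ^ n) (by positivity) (3 * (n + 1)))
    rw [sub_add_sub_cancel] at h1
    have h2 : cayleyProd τ (n + 1)
        = fun x => cayleyProd τ n x * cayley (τ * 4 ^ n) x ^ (3 * (n + 1)) := by
      funext x; simp [cayleyProd, Finset.prod_range_succ]
    rw [h2]
    exact h1

theorem exists_le_mul_four_pow {τ : ℝ} (hτ : 0 < τ) (M : ℝ) : ∃ n : ℕ, M ≤ τ * 4 ^ n := by
  obtain ⟨n, hn⟩ := pow_unbounded_of_one_lt (M / τ) (by norm_num : (1 : ℝ) < 4)
  exact ⟨n, by rw [mul_comm]; exact ((div_lt_iff₀ hτ).1 hn).le⟩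

/-- If `a ^ 2` and `b ^ 2` are intertwined by `Z` modulo the separable ideal, then so are the
non-negative operators `a` and `b`. -/
theorem intertwine_sqrt_mem {θ : ℝ} (hθ : 0 < θ) {a : G →L[ℂ] G} {b : H →L[ℂ] H} (ha : 0 ≤ a)
    (hb : 0 ≤ b) {Z : H →L[ℂ] G} (hZ : Z ∈ weakSchatten θ)
    (h : a ∘L a ∘L Z - Z ∘L b ∘L b ∈ weakSchattenZero θ) :
    a ∘L Z - Z ∘L b ∈ weakSchattenZero θ := by
  set X := a ∘L Z - Z ∘L b with hX
  have hK : a ∘L X + X ∘L b = a ∘L a ∘L Z - Z ∘L b ∘L b := by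
    ext x; simp [hX]
  obtain ⟨C, hC⟩ := mem_weakSchatten_iff.1 hZ
  have hC0 := hC.nonneg
  rw [mem_weakSchattenZero_iff]
  intro ε hε
  -- Each of the two additions below costs a factor `2 ^ θ`; `C + 1` keeps `D` positive. Then `τ` is
  -- fixed by `τ ^ θ * D = ε / 2`.
  set D : ℝ := 2 ^ θ * (2 ^ θ * (C + 1) * 2) with hD
  have hD0 : 0 < D := by positivity
  set τ : ℝ := (ε / 2 / D) ^ θ⁻¹ with hτd
  have hτ : 0 < τ := by positivity
  have hτθ : τ ^ θ = ε / 2 / D := Real.rpow_inv_rpow (by positivity) hθ.ne'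
  obtain ⟨n, hn⟩ := exists_le_mul_four_pow hτ (max ‖a‖ ‖b‖)
  have hna := norm_mul_cfc_cayleyProd_le ha hτ ((le_max_left _ _).trans hn)
  have hnb := norm_mul_cfc_cayleyProd_le hb hτ ((le_max_right _ _).trans hn)
  have hf := isContr_cayleyProd hτ n
  have h1 := mem_weakSchattenZero_iff.1 (sylvester_prod_mem ha hb hK h hτ n)
    (ε / 2 / 2 ^ θ) (by positivity)
  set f := cayleyProd τ n with hfd
  have h2 : cfc f a ∘L X ∘L cfc f b
      = (cfc f a * a) ∘L (Z ∘L cfc f b) + (cfc f a) ∘L (Z ∘L (-(b * cfc f b))) := by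
    ext x; simp [hX]; abel
  have h3 : CountLE θ (τ ^ θ * C) ((cfc f a * a) ∘L (Z ∘L cfc f b)) := by
    simpa using (hC.comp_right one_pos (hf.norm_cfc_le hb)).comp_left hτ hna.1
  have h4 : CountLE θ (τ ^ θ * C) ((cfc f a) ∘L (Z ∘L (-(b * cfc f b)))) := by
    simpa using (hC.comp_right (B := -(b * cfc f b)) hτ (by rw [norm_neg]; exact hnb.2)).comp_left
      one_pos (hf.norm_cfc_le ha)
  have h5 := h3.add h4
  rw [← h2] at h5
  have h6 := h1.add h5
  rw [sub_add_cancel] at h6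
  refine h6.mono ?_
  have hp : (0 : ℝ) < 2 ^ θ := by positivity
  have h7 : 2 ^ θ * (2 ^ θ * (τ ^ θ * C + τ ^ θ * C)) ≤ ε / 2 := by
    have : 2 ^ θ * (2 ^ θ * (τ ^ θ * C + τ ^ θ * C)) ≤ τ ^ θ * D := by
      rw [hD]
      have : 0 ≤ 2 ^ θ * 2 ^ θ * τ ^ θ := by positivity
      nlinarith
    refine this.trans (le_of_eq ?_)
    rw [hτθ]
    field_simp
  have h8 : 2 ^ θ * (ε / 2 / 2 ^ θ) = ε / 2 := by field_simp
  rw [mul_add, h8]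
  linarith

theorem exists_sum_geometric_le {q : ℝ} (hq : 0 ≤ q) (hq1 : q < 1) :
    ∃ S : ℝ, 0 < S ∧ ∀ n : ℕ, ∑ i ∈ Finset.range n, (3 * (i + 1) : ℕ) * q ^ i ≤ S := by
  have hs : Summable fun i : ℕ => ((3 * (i + 1) : ℕ) : ℝ) * q ^ i := by
    have h1 := (summable_pow_mul_geometric_of_norm_lt_one 1
      (by rwa [Real.norm_of_nonneg hq] : ‖q‖ < 1)).mul_left 3
    have h2 := (summable_geometric_of_lt_one hq hq1).mul_left 3
    refine (h1.add h2).congr fun i => ?_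
    push_cast; ring
  have h0 : ∀ i : ℕ, 0 ≤ ((3 * (i + 1) : ℕ) : ℝ) * q ^ i := fun i => by positivity
  refine ⟨(∑' i : ℕ, ((3 * (i + 1) : ℕ) : ℝ) * q ^ i) + 1,
    add_pos_of_nonneg_of_pos (tsum_nonneg h0) one_pos, fun n => ?_⟩
  exact (hs.sum_le_tsum _ fun i _ => h0 i).trans (by linarith)

/-- A bound for approximation numbers that is valid at all scales. -/
theorem exists_apx_le {θ : ℝ} (hθ : 0 < θ) {K : H →L[ℂ] G} (hK : K ∈ weakSchattenZero θ) {ε : ℝ}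
    (hε : 0 < ε) : ∃ C : ℝ, 0 < C ∧ ∀ s : ℝ, 0 < s →
      ∃ k : ℕ, (k : ℝ) ≤ ε * s ^ (-θ) + C * s ^ (-(θ / 2)) ∧ Apx K k s := by
  obtain ⟨r, hr, hp⟩ := mem_nhdsGT_iff_exists_Ioo_subset.1 (mem_weakSchattenZero_iff.1 hK ε hε)
  have hr : 0 < r := hr
  obtain ⟨k₀, -, hk₀⟩ := hp (⟨by positivity, by linarith⟩ : r / 2 ∈ Set.Ioo 0 r)
  -- For `r ≤ s < ‖K‖` the fixed rank `k₀` suffices, and this `C` absorbs it into the lower-order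
  -- term; for `s ≥ ‖K‖` rank zero is enough.
  set C : ℝ := k₀ * (‖K‖ + 1) ^ (θ / 2) + 1 with hC
  have hC0 : 0 < C := by positivity
  refine ⟨C, hC0, fun s hs => ?_⟩
  rcases lt_or_ge s r with h1 | h1
  · obtain ⟨k, hk, ha⟩ := hp ⟨hs, h1⟩
    refine ⟨k, ?_, ha⟩
    have h2 : (k : ℝ) ≤ ε * s ^ (-θ) := by
      rw [Real.rpow_neg hs.le, ← div_eq_mul_inv, le_div_iff₀ (by positivity), mul_comm]
      exact hk
    have : 0 ≤ C * s ^ (-(θ / 2)) := by positivity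
    linarith
  · rcases le_or_gt ‖K‖ s with h2 | h2
    · exact ⟨0, by push_cast; positivity, apx_of_norm_le h2⟩
    · refine ⟨k₀, ?_, hk₀.mono le_rfl (by linarith)⟩
      have h3 : (k₀ : ℝ) ≤ C * s ^ (-(θ / 2)) := by
        rw [Real.rpow_neg hs.le, ← div_eq_mul_inv, le_div_iff₀ (by positivity)]
        have : s ^ (θ / 2) ≤ (‖K‖ + 1) ^ (θ / 2) := by gcongr; linarith
        have := mul_le_mul_of_nonneg_left this (Nat.cast_nonneg (α := ℝ) k₀)
        linarith
      have : 0 ≤ ε * s ^ (-θ) := by positivity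
      linarith

end Sylvester

/-! ### Square roots modulo the separable ideals -/

section SquareRoot

variable {H : Type*} [NormedAddCommGroup H] [InnerProductSpace ℂ H] [CompleteSpace H]

/-- If the squares of two non-negative operators agree modulo the separable ideal of order `θ`,
then the operators agree modulo the separable ideal of order `2 * θ`. -/
theorem sub_mem_of_sq_sub_sq_mem {θ : ℝ} (hθ : 0 < θ) {a b : H →L[ℂ] H} (ha : 0 ≤ a)
    (hb : 0 ≤ b) (h : a ∘L a - b ∘L b ∈ weakSchattenZero θ) :
    a - b ∈ weakSchattenZero (2 * θ) := by
  have hK : a ∘L (a - b) + (a - b) ∘L b = a ∘L a - b ∘L b := by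
    ext x; simp
  obtain ⟨S₁, hS₁, hS₁'⟩ := exists_sum_geometric_le (q := 2 ^ (-θ)) (by positivity)
    (Real.rpow_lt_one_of_one_lt_of_neg (by norm_num) (by linarith))
  obtain ⟨S₂, hS₂, hS₂'⟩ := exists_sum_geometric_le (q := 2 ^ (-(θ / 2))) (by positivity)
    (Real.rpow_lt_one_of_one_lt_of_neg (by norm_num) (by linarith))
  obtain ⟨S₃, hS₃, hS₃'⟩ := exists_sum_geometric_le (q := 1 / 2) (by norm_num) (by norm_num)
  rw [mem_weakSchattenZero_iff]
  intro ε hε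
  -- The iteration errors sum to at most `2 S₃ τ` and the remainder adds `2 τ`. The power of `M` in
  -- `η` compensates for the final rescaling `t = M τ`.
  set M : ℝ := 2 * S₃ + 2 with hM
  have hM0 : 0 < M := by positivity
  set η : ℝ := ε / M ^ (2 * θ) with hη
  have hη0 : 0 < η := by positivity
  obtain ⟨C, hC, hN⟩ := exists_apx_le hθ h (ε := η / 2 / S₁) (by positivity)
  have hsmall : ∀ᶠ τ : ℝ in 𝓝[>] 0, C * S₂ * τ ^ θ ≤ η / 2 := by
    have hc : Filter.Tendsto (fun τ : ℝ => C * S₂ * τ ^ θ) (𝓝 0) (𝓝 (C * S₂ * 0 ^ θ)) :=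
      ((Real.continuous_rpow_const hθ.le).tendsto 0).const_mul _
    rw [Real.zero_rpow hθ.ne', mul_zero] at hc
    exact (hc.mono_left nhdsWithin_le_nhds).eventually_le_const (by positivity)
  have hmain : ∀ᶠ τ : ℝ in 𝓝[>] 0,
      ∃ k : ℕ, τ ^ (2 * θ) * k ≤ η ∧ Apx (a - b) k (M * τ) := by
    filter_upwards [hsmall, self_mem_nhdsWithin] with τ hτs hτ
    have hτ : 0 < τ := hτ
    -- At shift `τ 4^i` the operator `K` is approximated to precision `τ² 2^i`. The errors, of order
    -- `τ² 2^i / (τ 4^i)`, and the rank bounds both decay geometrically in `i`, which defeats the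
    -- multiplicity `3(i+1)`. As `i` is unrestricted, a rank bound valid at all scales is needed.
    choose k hk hak using fun i : ℕ => hN (τ ^ 2 * 2 ^ i) (by positivity)
    obtain ⟨n, hn⟩ := exists_le_mul_four_pow hτ (max ‖a‖ ‖b‖)
    have hna := norm_mul_cfc_cayleyProd_le ha hτ ((le_max_left _ _).trans hn)
    have hnb := norm_mul_cfc_cayleyProd_le hb hτ ((le_max_right _ _).trans hn)
    have hf := isContr_cayleyProd hτ n
    have h1 := sylvester_prod_apx ha hb hK hτ hak n
    have h2 : ‖cfc (cayleyProd τ n) a ∘L (a - b) ∘L cfc (cayleyProd τ n) b‖ ≤ 2 * τ := by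
      have : cfc (cayleyProd τ n) a ∘L (a - b) ∘L cfc (cayleyProd τ n) b
          = cfc (cayleyProd τ n) a * a * cfc (cayleyProd τ n) b
            - cfc (cayleyProd τ n) a * (b * cfc (cayleyProd τ n) b) := by
        ext x; simp
      rw [this]
      have h3 : ‖cfc (cayleyProd τ n) a * a * cfc (cayleyProd τ n) b‖ ≤ τ * 1 :=
        (norm_mul_le _ _).trans
          (mul_le_mul hna.1 (hf.norm_cfc_le hb) (norm_nonneg _) hτ.le)
      have h4 : ‖cfc (cayleyProd τ n) a * (b * cfc (cayleyProd τ n) b)‖ ≤ 1 * τ :=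
        (norm_mul_le _ _).trans
          (mul_le_mul (hf.norm_cfc_le ha) hnb.2 (norm_nonneg _) zero_le_one)
      exact (norm_sub_le _ _).trans (by linarith)
    have h5 := h1.add (apx_of_norm_le h2)
    rw [sub_add_cancel] at h5
    refine ⟨_, ?_, h5.mono le_rfl ?_⟩
    · have hterm : ∀ i : ℕ, τ ^ (2 * θ) * k i
          ≤ η / 2 / S₁ * (2 ^ (-θ)) ^ i + C * τ ^ θ * (2 ^ (-(θ / 2))) ^ i := by
        intro i
        have e1 : (τ ^ 2 * 2 ^ i : ℝ) ^ (-θ) = (τ ^ (2 * θ))⁻¹ * (2 ^ (-θ)) ^ i := by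
          rw [Real.mul_rpow (by positivity) (by positivity), ← Real.rpow_natCast τ 2,
            ← Real.rpow_mul hτ.le, ← Real.rpow_neg hτ.le, ← Real.rpow_natCast 2 i,
            ← Real.rpow_natCast (2 ^ (-θ)) i, ← Real.rpow_mul (by norm_num),
            ← Real.rpow_mul (by norm_num)]
          congr 2 <;> push_cast <;> ring
        have e2 : (τ ^ 2 * 2 ^ i : ℝ) ^ (-(θ / 2)) = (τ ^ θ)⁻¹ * (2 ^ (-(θ / 2))) ^ i := by
          rw [Real.mul_rpow (by positivity) (by positivity), ← Real.rpow_natCast τ 2,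
            ← Real.rpow_mul hτ.le, ← Real.rpow_neg hτ.le, ← Real.rpow_natCast 2 i,
            ← Real.rpow_natCast (2 ^ (-(θ / 2))) i, ← Real.rpow_mul (by norm_num),
            ← Real.rpow_mul (by norm_num)]
          congr 2 <;> push_cast <;> ring
        have e3 : τ ^ (2 * θ) = τ ^ θ * τ ^ θ := by
          rw [← Real.rpow_add hτ]; ring_nf
        have hk' := hk i
        rw [e1, e2] at hk'
        have hp : 0 < τ ^ θ := by positivity
        refine (mul_le_mul_of_nonneg_left hk' (by positivity : 0 ≤ τ ^ (2 * θ))).trans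
          (le_of_eq ?_)
        rw [e3]
        field_simp
      rw [add_zero]
      push_cast
      rw [Finset.mul_sum]
      calc ∑ i ∈ Finset.range n, τ ^ (2 * θ) * (3 * ((i : ℝ) + 1) * k i)
          ≤ ∑ i ∈ Finset.range n, (η / 2 / S₁ * ((3 * (i + 1) : ℕ) * (2 ^ (-θ)) ^ i)
              + C * τ ^ θ * ((3 * (i + 1) : ℕ) * (2 ^ (-(θ / 2))) ^ i)) := by
            refine Finset.sum_le_sum fun i _ => ?_
            have := mul_le_mul_of_nonneg_left (hterm i) (by positivity : 0 ≤ 3 * ((i : ℝ) + 1))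
            push_cast
            linarith
        _ = η / 2 / S₁ * ∑ i ∈ Finset.range n, ((3 * (i + 1) : ℕ) : ℝ) * (2 ^ (-θ)) ^ i
            + C * τ ^ θ * ∑ i ∈ Finset.range n, ((3 * (i + 1) : ℕ) : ℝ) * (2 ^ (-(θ / 2))) ^ i := by
            rw [Finset.sum_add_distrib, Finset.mul_sum, Finset.mul_sum]
        _ ≤ η / 2 / S₁ * S₁ + C * τ ^ θ * S₂ := by
            gcongr
            · exact hS₁' n
            · exact hS₂' n
        _ ≤ η := by
            rw [div_mul_cancel₀ _ hS₁.ne']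
            linarith
    · have h6 : ∑ i ∈ Finset.range n,
          ((3 * (i + 1) : ℕ) : ℝ) * (2 * (τ ^ 2 * 2 ^ i) / (τ * 4 ^ i))
          = 2 * τ * ∑ i ∈ Finset.range n, ((3 * (i + 1) : ℕ) : ℝ) * (1 / 2) ^ i := by
        rw [Finset.mul_sum]
        refine Finset.sum_congr rfl fun i _ => ?_
        have : (4 : ℝ) ^ i = 2 ^ i * 2 ^ i := by rw [← mul_pow]; norm_num
        rw [this, one_div, inv_pow]
        field_simp
      rw [h6, hM]
      have := mul_le_mul_of_nonneg_left (hS₃' n) (by positivity : 0 ≤ 2 * τ)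
      linarith
  filter_upwards [eventually_mul_nhdsGT_zero hmain (inv_pos.2 hM0), self_mem_nhdsWithin]
    with t ht h0
  have h0 : 0 < t := h0
  obtain ⟨k, hk, ha⟩ := ht
  rw [mul_inv_cancel_left₀ hM0.ne'] at ha
  refine ⟨k, ?_, ha⟩
  have h2 : t ^ (2 * θ) = M ^ (2 * θ) * (M⁻¹ * t) ^ (2 * θ) := by
    rw [← Real.mul_rpow hM0.le (by positivity), mul_inv_cancel_left₀ hM0.ne']
  rw [h2, mul_assoc]
  refine (mul_le_mul_of_nonneg_left hk (by positivity)).trans (le_of_eq ?_)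
  rw [hη]
  field_simp

end SquareRoot

end SignSep

namespace SignSep

/-! ### Intertwining and the absolute value of `T(V)` -/

section Main

variable {H G : Type*}
  [NormedAddCommGroup H] [InnerProductSpace ℂ H] [CompleteSpace H]
  [NormedAddCommGroup G] [InnerProductSpace ℂ G] [CompleteSpace G]

theorem adjoint_comp_self_nonneg (T : H →L[ℂ] H) : 0 ≤ T.adjoint ∘L T :=
  (ContinuousLinearMap.nonneg_iff_isPositive _).2
    (ContinuousLinearMap.isPositive_adjoint_comp_self T)

theorem absOp_nonneg (T : H →L[ℂ] H) : 0 ≤ absOp T := CFC.sqrt_nonneg _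

theorem absOp_comp_self (T : H →L[ℂ] H) : absOp T ∘L absOp T = T.adjoint ∘L T :=
  CFC.sqrt_mul_sqrt_self _ (adjoint_comp_self_nonneg T)

theorem adjoint_absOp (T : H →L[ℂ] H) : (absOp T).adjoint = absOp T :=
  (IsSelfAdjoint.of_nonneg (absOp_nonneg T)).star_eq

/-- If the trace operator lifts `W` to `L` on the range of `A`, then `W Z - Z L` is the trace of
the commutator. -/
theorem intertwine_mem_of_liftsOn {θ : ℝ} {γ : H →ₗ.[ℂ] G} {A L : H →L[ℂ] H} {Z : H →L[ℂ] G}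
    {W : G →L[ℂ] G} (hZ : IsTraceComp γ A Z) (hlift : LiftsOn γ W L A)
    (hcomm : TraceMemZero γ (L * A - A * L) θ) : W ∘L Z - Z ∘L L ∈ weakSchattenZero θ := by
  obtain ⟨E, hE, hmem⟩ := hcomm
  convert hmem using 1
  ext x
  obtain ⟨h₀, h₀'⟩ := hE x
  obtain ⟨h₁, h₁'⟩ := hZ x
  obtain ⟨h₂, h₂'⟩ := hZ (L x)
  obtain ⟨h₃, h₄, h₄'⟩ := hlift x
  rw [sub_apply, ContinuousLinearMap.comp_apply,
    ContinuousLinearMap.comp_apply, ← h₁', ← h₂', ← h₀', h₄', ← LinearPMap.map_sub]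
  rfl

/-- Modulo the separable ideal, `T(U)* T(U)` depends on `U* U` only. -/
theorem opT_adjoint_comp_opT_mem {θ : ℝ} (hθ : 0 < θ) {Z : H →L[ℂ] G}
    (hZ : Z ∈ weakSchatten (2 * (2 * θ))) {U : G →L[ℂ] G} {L : H →L[ℂ] H}
    (h₁ : U ∘L Z - Z ∘L L ∈ weakSchattenZero (2 * (2 * θ)))
    (h₂ : U.adjoint ∘L Z - Z ∘L L.adjoint ∈ weakSchattenZero (2 * (2 * θ))) :
    (opT Z U).adjoint ∘L opT Z U - (Z.adjoint ∘L Z) ∘L (Z.adjoint ∘L (U.adjoint ∘L U) ∘L Z)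
      ∈ weakSchattenZero θ := by
  have hθ2 : 0 < 2 * θ := by positivity
  have hZ' := weakSchatten_adjoint hZ
  have hUZ := weakSchatten_comp_left hZ U
  -- In `Z*U*Z Z*UZ`, the term `e₁` accounts for replacing `U*Z` by `ZL*`, and `e₂` for replacing
  -- `Z*U*` by `L*Z*` in the target `Z*Z Z*U*UZ`. Both replacements meet in `Z*Z L*Z*UZ`, which
  -- cancels in `e₁ - e₂`.
  have e₁ : (Z.adjoint ∘L (U.adjoint ∘L Z - Z ∘L L.adjoint)) ∘L (Z.adjoint ∘L (U ∘L Z))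
      ∈ weakSchattenZero θ :=
    weakSchattenZero_comp_of_mem_right hθ (weakSchattenZero_comp_of_mem_left hθ2 hZ' h₂)
      (weakSchatten_comp hZ' hUZ)
  have e₂ : (Z.adjoint ∘L Z) ∘L ((U ∘L Z - Z ∘L L).adjoint ∘L (U ∘L Z)) ∈ weakSchattenZero θ :=
    weakSchattenZero_comp_of_mem_left hθ (weakSchatten_comp hZ' hZ)
      (weakSchattenZero_comp_of_mem_right hθ2 (weakSchattenZero_adjoint h₁) hUZ)
  convert weakSchattenZero_sub e₁ e₂ using 1
  ext x
  simp [opT, ContinuousLinearMap.adjoint_comp]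

theorem opT_nonneg (Z : H →L[ℂ] G) {U : G →L[ℂ] G} (hU : 0 ≤ U) : 0 ≤ opT Z U :=
  (ContinuousLinearMap.nonneg_iff_isPositive _).2
    (((ContinuousLinearMap.nonneg_iff_isPositive U).1 hU).adjoint_conj Z)

/-- If `V` and its adjoint are intertwined with `L` and its adjoint by `Z` modulo the separable
ideal, then so are `|V|` and `|L|` (`intertwine_sqrt_mem`). Hence no operators approximating `|L|`
that almost commute with the underlying compact operator have to be prescribed. -/
theorem opT_absOp_sub_absOp_opT_mem {θ : ℝ} (hθ : 0 < θ) {Z : H →L[ℂ] G}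
    (hZ : Z ∈ weakSchatten (2 * θ)) {V : G →L[ℂ] G} {L : H →L[ℂ] H}
    (h₁ : V ∘L Z - Z ∘L L ∈ weakSchattenZero (2 * θ))
    (h₂ : V.adjoint ∘L Z - Z ∘L L.adjoint ∈ weakSchattenZero (2 * θ)) :
    opT Z (absOp V) - absOp (opT Z V) ∈ weakSchattenZero θ := by
  -- Squares are compared at half the order, `ρ = θ / 2`, and the square root lemma doubles it
  -- again.
  obtain ⟨ρ, rfl⟩ : ∃ ρ, θ = 2 * ρ := ⟨θ / 2, by ring⟩
  have hρ : 0 < ρ := by linarith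
  have h₃ : absOp V ∘L Z - Z ∘L absOp L ∈ weakSchattenZero (2 * (2 * ρ)) := by
    refine intertwine_sqrt_mem (by positivity) (absOp_nonneg V) (absOp_nonneg L) hZ ?_
    rw [← ContinuousLinearMap.comp_assoc, absOp_comp_self, absOp_comp_self]
    convert weakSchattenZero_add (weakSchattenZero_comp_left h₁ V.adjoint)
      (weakSchattenZero_comp_right h₂ L) using 1
    ext x
    simp
  have h₄ : (absOp V).adjoint ∘L Z - Z ∘L (absOp L).adjoint ∈ weakSchattenZero (2 * (2 * ρ)) := by
    rwa [adjoint_absOp, adjoint_absOp]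
  refine sub_mem_of_sq_sub_sq_mem hρ (opT_nonneg Z (absOp_nonneg V)) (absOp_nonneg _) ?_
  -- Since `|V|² = V*V`, both comparisons have the same reference operator, which cancels in the
  -- difference.
  have h₅ := weakSchattenZero_sub (opT_adjoint_comp_opT_mem hρ hZ h₃ h₄)
    (opT_adjoint_comp_opT_mem hρ hZ h₁ h₂)
  have h₆ : (opT Z (absOp V)).adjoint = opT Z (absOp V) :=
    (IsSelfAdjoint.of_nonneg (opT_nonneg Z (absOp_nonneg V))).star_eq
  rwa [adjoint_absOp, absOp_comp_self, sub_sub_sub_cancel_right, h₆,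
    ← absOp_comp_self (opT Z V)] at h₅

end Main

end SignSep

theorem mainTheorem2
    {H G : Type*}
    [NormedAddCommGroup H] [InnerProductSpace ℂ H] [CompleteSpace H]
    [NormedAddCommGroup G] [InnerProductSpace ℂ G] [CompleteSpace G]
    (θ : ℝ) (hθ : 0 < θ)
    -- the compact operator `A`, the trace operator `γ` and the bounded operator `Z = γ A`
    (A : H →L[ℂ] H) (hA : IsCompactOperator A)
    (γ : H →ₗ.[ℂ] G)
    (Z : H →L[ℂ] G) (hZ : SignSep.IsTraceComp γ A Z)
    -- the weight `V` and its lift `Vt`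
    (V : G →L[ℂ] G) (Vt : H →L[ℂ] H)
    (hlift₁ : SignSep.LiftsOn γ V Vt A)
    (hlift₂ : SignSep.LiftsOn γ V.adjoint Vt.adjoint A.adjoint)
    (hlift₃ : SignSep.LiftsOn γ V.adjoint Vt.adjoint A)
    (hlift₄ : SignSep.LiftsOn γ V Vt A.adjoint)
    (hZmem : Z ∈ SignSep.weakSchatten (2 * θ))
    (hVA : SignSep.TraceMem γ (Vt * A) (2 * θ))
    (hVA' : SignSep.TraceMem γ (Vt.adjoint * A) (2 * θ))
    (hcomm : SignSep.TraceMemZero γ (Vt * A - A * Vt) (2 * θ))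
    (hcomm' : SignSep.TraceMemZero γ (Vt.adjoint * A - A * Vt.adjoint) (2 * θ))
    -- the approximating family
    (Y : ℝ → H →L[ℂ] H)
    (hYpos : ∀ ε : ℝ, 0 < ε → (Y ε).IsPositive)
    (hYapprox : ∀ ε : ℝ, 0 < ε → ∃ R : H →L[ℂ] G,
      SignSep.IsTraceComp γ ((SignSep.absOp Vt ^ 2 - Y ε ^ 2) * A) R ∧
      IsCompactOperator R ∧ SignSep.upperCoeff (2 * θ) R ≤ ENNReal.ofReal ε)
    (hYcomm : ∀ ε : ℝ, 0 < ε →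
      SignSep.TraceMemZero γ (Y ε * A - A * Y ε) (2 * θ))
    (hYcomm' : ∀ ε : ℝ, 0 < ε →
      SignSep.TraceMemZero γ (Y ε * A.adjoint - A.adjoint * Y ε) (2 * θ)) :
    SignSep.opT Z (SignSep.absOp V) - SignSep.absOp (SignSep.opT Z V)
        ∈ SignSep.weakSchattenZero θ ∧
    (IsSelfAdjoint V →
      SignSep.posOp (SignSep.opT Z V) - SignSep.opT Z (SignSep.posOp V)
          ∈ SignSep.weakSchattenZero θ ∧
      SignSep.negOp (SignSep.opT Z V) - SignSep.opT Z (SignSep.negOp V)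
          ∈ SignSep.weakSchattenZero θ) := by
  have h := SignSep.opT_absOp_sub_absOp_opT_mem hθ hZmem
    (SignSep.intertwine_mem_of_liftsOn hZ hlift₁ hcomm)
    (SignSep.intertwine_mem_of_liftsOn hZ hlift₃ hcomm')
  refine ⟨h, fun _ => ⟨?_, ?_⟩⟩
  -- Since `opT Z` is linear in the weight, the `T(V)` terms cancel, leaving half of `|T(V)| -
  -- T(|V|)`; the same holds for the negative parts.
  · convert SignSep.weakSchattenZero_smul h (-(1 / 2)) using 1
    ext x
    simp [SignSep.posOp, SignSep.opT]
    module
  · convert SignSep.weakSchattenZero_smul h (-(1 / 2)) using 1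
    ext x
    simp [SignSep.negOp, SignSep.opT]
    module
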